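/- A numerical semigroup is a subset $S\subseteq\mathbb N=\{0,1,2,\dots\}$ that contains $0$ and is closed under addition; it need not be cofinite. Let $k\ge 0$ be an integer and let $S\neq\{0\}$ be a numerical semigroup. Then the following are equivalent. (1) $S$ is a $k$-quotient: there are positive integers $d,a_1,\dots,a_k$ such that $S=\langle a_1,\dots,a_k\rangle/d:=\{t\in\mathbb N : dt\in\langle a_1,\dots,a_k\rangle\}$, where $\langle a_1,\dots,a_k\rangle=\{a_1x_1+\cdots+a_kx_k : x_i\in\mathbb N\}$. (2) $S$ is $k$-ray-normalescent: there are an integer $m\ge 0$, a pointed rational polyhedral cone $C\subseteq\mathbb R^m$ with exactly $k$ extreme rays (that is, $C$ is the set of nonnegative real combinations of finitely many vectors of $\mathbb Z^m$, and $C\cap(-C)=\{0\}$; an extreme ray is a one-dimensional face), and a linear map $\pi:\mathbb R^m\to\mathbb R$ with integer coefficients and $\pi(C)\subseteq\mathbb R_{\ge 0}$, such that $S=\pi(C\cap\mathbb Z^m)$. -/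

import Mathlib

/-- A numerical semigroup: a subset of `ℕ` that contains `0` and is closed under addition
(no cofiniteness is required). -/
abbrev NumericalSemigroup : Type := AddSubmonoid ℕ

namespace NumericalSemigroup

/-- The quotient `S / d = {t ∈ ℕ : d t ∈ S}`. -/
def quotient (S : NumericalSemigroup) (d : ℕ) : NumericalSemigroup where
  carrier := {t | d * t ∈ S}
  zero_mem' := by simp
  add_mem' := by
    intro s t hs ht
    simpa [mul_add] using S.add_mem hs ht

/-- `S` is a `k`-quotient: `S = ⟨a₁, …, a_k⟩ / d` for some positive integers `d, a₁, …, a_k`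
(not necessarily distinct or minimal generators). -/
def IsQuotient (k : ℕ) (S : NumericalSemigroup) : Prop :=
  ∃ (d : ℕ) (a : Fin k → ℕ), 0 < d ∧ (∀ i, 0 < a i) ∧
    S = quotient (AddSubmonoid.closure (Set.range a)) d

end NumericalSemigroup

/-- The integer lattice `ℤ^m` inside `ℝ^m`. -/
def integerPoints (m : ℕ) : Set (Fin m → ℝ) :=
  Set.range fun (z : Fin m → ℤ) (i : Fin m) => (z i : ℝ)

/-- A rational polyhedral cone in `ℝ^m`: the set of nonnegative real combinations of finitely many
integer vectors. -/
def IsRationalPolyhedral {m : ℕ} (C : PointedCone ℝ (Fin m → ℝ)) : Prop :=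
  ∃ V : Set (Fin m → ℝ), V.Finite ∧ V ⊆ integerPoints m ∧ C = PointedCone.hull ℝ V

/-- The extreme rays of a cone: its faces of the form `{r v : r ≥ 0}` with `v ≠ 0`. -/
def extremeRays {m : ℕ} (C : PointedCone ℝ (Fin m → ℝ)) : Set (PointedCone ℝ (Fin m → ℝ)) :=
  {F | F.IsFaceOf C ∧ ∃ v : Fin m → ℝ, v ≠ 0 ∧ F = PointedCone.hull ℝ {v}}

namespace NumericalSemigroup

/-- `S` is `k`-ray-normalescent: `S = π(C ∩ ℤ^m)` for a rational polyhedral cone `C ⊆ ℝ^m` that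
contains no line and has exactly `k` extreme rays, and a linear map `π : ℝ^m → ℝ` with integer
coefficients that is nonnegative on `C`. Mathlib's `PointedCone` only means that the cone contains
`0`; that the cone contains no line is `ConvexCone.Salient`. -/
def IsRayNormalescent (k : ℕ) (S : NumericalSemigroup) : Prop :=
  ∃ (m : ℕ) (C : PointedCone ℝ (Fin m → ℝ)) (π : (Fin m → ℝ) →ₗ[ℝ] ℝ),
    IsRationalPolyhedral C ∧ (C : ConvexCone ℝ (Fin m → ℝ)).Salient ∧
    (extremeRays C).encard = k ∧
    (∀ i, ∃ c : ℤ, π (Pi.single i 1) = c) ∧ (∀ x ∈ C, 0 ≤ π x) ∧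
    (Nat.cast '' (S : Set ℕ) : Set ℝ) = π '' ((C : Set (Fin m → ℝ)) ∩ integerPoints m)

end NumericalSemigroup

/-! For `⟨a₁, …, a_k⟩/d`, the cone spanned by the `k` independent vectors `(a_i, d e_i)` and the
first coordinate work: an integer point `(t, x)` of it is exactly an `x ≥ 0` with `∑ x_i a_i = d t`.

Conversely, minimal integer generators `v_i` of `C` span its `k` extreme rays but may be dependent.
This is removed by passing to the lattice of pairs `(x, z)` with `∑ x_i v_i = n z`, of rank `k`,
where `n` clears denominators for a finite generating set of `S`. There `S` is the set of values of
`τ(x, z) = π z` on the simplicial cone `x ≥ 0` (`isQuotient_of_rational_cone`).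

A simplicial cone gives a quotient when its lattice is cut out of `ℤ^k` by a single congruence. This
can be arranged because there is room to perturb the facets: a large multiple of the gcd of `S` lies
in `S` anyway, so only points with small `τ` must stay in the old cone, and only the generators of
`S` must still be attained. A first perturbation makes the generators interior and `τ` positive. A
second one replaces the matrix `M` of facet forms by `N M + 1`, whose determinant `D` is prime to
`N`; in a triangular basis a suitable minor is then prime to `D`, and `∑ x_i a_i ≡ 0 mod |D|`
describes the lattice up to a factor prime to `D` (`isQuotient_of_forms`). -/

/-! ### Integral matrices: triangular bases, lattices cut out by one congruence, perturbed cones -/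

open Module in
/-- `r` jointly injective integral linear forms on a lattice of rank `r` become lower triangular,
with nonzero diagonal, in a suitable basis of the lattice. -/
theorem exists_basis_triangular (r : ℕ) : ∀ {V : Type*} [AddCommGroup V] [Module.Free ℤ V]
    [Module.Finite ℤ V] (_ : finrank ℤ V = r) (f : Fin r → V →ₗ[ℤ] ℤ)
    (_ : ∀ v, (∀ i, f i v = 0) → v = 0),
    ∃ b : Basis (Fin r) ℤ V, (∀ i j, i < j → f i (b j) = 0) ∧ ∀ i, f i (b i) ≠ 0 := by
  induction r with
  | zero =>
    intro V _ _ _ hr f _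
    exact ⟨finBasisOfFinrankEq ℤ V hr, fun i => i.elim0, fun i => i.elim0⟩
  | succ r ih =>
    intro V _ _ _ hr f hf
    have h0 : f 0 ≠ 0 := by
      intro h0
      -- Otherwise the other `r` forms would embed a lattice of rank `r + 1` in `ℤ^r`.
      have hinj : Function.Injective (LinearMap.pi fun i : Fin r => f i.succ) := by
        rw [← LinearMap.ker_eq_bot, LinearMap.ker_eq_bot']
        intro v hv
        refine hf v fun i => ?_
        refine Fin.cases (by simp [h0]) (fun i => ?_) i
        exact congrFun hv i
      have := LinearMap.finrank_le_finrank_of_injective hinj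
      simp [hr] at this
    obtain ⟨g, hg⟩ : ∃ g : ℤ, LinearMap.range (f 0) = Submodule.span ℤ {g} :=
      ((IsPrincipalIdealRing.principal (R := ℤ) (LinearMap.range (f 0))).principal)
    have hg0 : g ≠ 0 := by
      rintro rfl
      apply h0
      rw [← LinearMap.range_eq_bot, hg]
      simp
    obtain ⟨y, hy⟩ : ∃ y, f 0 y = g := by
      have : g ∈ LinearMap.range (f 0) := by rw [hg]; exact Submodule.mem_span_singleton_self g
      exact this
    have hli : ∀ (c : ℤ), ∀ x ∈ LinearMap.ker (f 0), c • y + x = 0 → c = 0 := by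
      intro c x hx hc
      have := congrArg (f 0) hc
      rw [LinearMap.mem_ker] at hx
      simpa [hx, hy, hg0] using this
    have hsp : ∀ z : V, ∃ c : ℤ, z + c • y ∈ LinearMap.ker (f 0) := by
      intro z
      have hz : f 0 z ∈ LinearMap.range (f 0) := ⟨z, rfl⟩
      rw [hg, Submodule.mem_span_singleton] at hz
      obtain ⟨a, ha⟩ := hz
      refine ⟨-a, ?_⟩
      simp [hy, ← ha]
    have hker : finrank ℤ (LinearMap.ker (f 0)) = r := by
      have h2 := finrank_eq_card_basis (Basis.mkFinCons y (finBasis ℤ (LinearMap.ker (f 0))) hli hsp)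
      simp only [Fintype.card_fin] at h2
      omega
    obtain ⟨b, hb, hb'⟩ := ih hker (fun i => (f i.succ).comp (LinearMap.ker (f 0)).subtype) (by
      intro v hv
      apply Subtype.ext
      refine hf v fun i => ?_
      refine Fin.cases v.2 (fun i => hv i) i)
    refine ⟨Basis.mkFinCons y b hli hsp, ?_, ?_⟩
    · intro i j hij
      rw [Basis.coe_mkFinCons]
      induction j using Fin.cases with
      | zero => exact absurd hij (Fin.not_lt_zero i)
      | succ j =>
        induction i using Fin.cases with
        | zero => exact (b j).2
        | succ i => exact hb i j (Fin.succ_lt_succ_iff.mp hij)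
    · intro i
      rw [Basis.coe_mkFinCons]
      induction i using Fin.cases with
      | zero => simpa [hy] using hg0
      | succ i => exact hb' i

open Matrix

/-- If the minor obtained by deleting the last row and the first column is coprime to the
determinant `D`, then the lattice `M ℤⁿ` is cut out by the single congruence
`(adj M * x) 0 ≡ 0 mod D`. -/
theorem exists_mulVec_eq_of_det_dvd {r : ℕ} (M : Matrix (Fin (r + 1)) (Fin (r + 1)) ℤ)
    (hD : M.det ≠ 0) (hc : IsCoprime M.det (M.submatrix Fin.castSucc Fin.succ).det)
    (x : Fin (r + 1) → ℤ) (hx : M.det ∣ (M.adjugate *ᵥ x) 0) : ∃ u, M *ᵥ u = x := by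
  set Q := M.submatrix Fin.castSucc Fin.succ with hQ
  set v := M.adjugate *ᵥ x with hv
  have hMv : M *ᵥ v = M.det • x := by
    rw [hv, mulVec_mulVec, mul_adjugate, smul_mulVec, one_mulVec]
  obtain ⟨t, ht⟩ := hx
  -- With the first coordinate of `v` divisible by `D`, the others solve a system modulo `D` whose
  -- matrix `Q` is invertible there.
  have hQv : Q *ᵥ (fun j => v j.succ) = M.det • fun i : Fin r => x i.castSucc - M i.castSucc 0 * t := by
    ext i
    have := congrFun hMv i.castSucc
    simp only [mulVec, dotProduct, Fin.sum_univ_succ, ht, Pi.smul_apply, smul_eq_mul] at this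
    simp only [mulVec, dotProduct, hQ, submatrix_apply, Pi.smul_apply, smul_eq_mul]
    linear_combination this
  have hdvd : ∀ j, M.det ∣ v j := by
    intro j
    refine Fin.cases ⟨t, ht⟩ (fun j => ?_) j
    have h2 := congrArg (fun w => (Q.adjugate *ᵥ w) j) hQv
    simp only [mulVec_mulVec, adjugate_mul, smul_mulVec, one_mulVec, mulVec_smul, Pi.smul_apply,
      smul_eq_mul] at h2
    exact hc.dvd_of_dvd_mul_left ⟨_, h2⟩
  choose u hu using hdvd
  refine ⟨u, ?_⟩
  have : v = M.det • u := funext hu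
  rw [this, mulVec_smul] at hMv
  exact smul_right_injective _ hD hMv

/-- A small perturbation `N M + 1` of a dilated cone `{u | 0 ≤ M u}` contains no new lattice points
on which a given positive functional is bounded. -/
theorem nonneg_of_perturbed_nonneg {r : ℕ} (M : Matrix (Fin (r + 1)) (Fin (r + 1)) ℤ) (g F : ℤ)
    (hpos : ∀ u, u ≠ 0 → (∀ i, 0 ≤ (M *ᵥ u) i) → 0 < g * u 0) :
    ∃ N₀ : ℤ, 0 < N₀ ∧ ∀ N, N₀ ≤ N → ∀ u, (∀ i, 0 ≤ N * (M *ᵥ u) i + u i) → g * u 0 ≤ F →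
      ∀ i, 0 ≤ (M *ᵥ u) i := by
  have hdet : M.det ≠ 0 := by
    intro h
    obtain ⟨u, hu, hMu⟩ := Matrix.exists_mulVec_eq_zero_iff.mpr h
    have h1 := hpos u hu (by simp [hMu])
    have h2 := hpos (-u) (by simpa using hu) (by simp [mulVec_neg, hMu])
    simp only [Pi.neg_apply] at h2
    linarith
  set D := M.det with hDdef
  -- `D' • M⁻¹`, up to sign, with positive determinant
  obtain ⟨D', A, hD', hAM⟩ : ∃ (D' : ℤ) (A : Matrix (Fin (r + 1)) (Fin (r + 1)) ℤ), 0 < D' ∧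
      A * M = D' • (1 : Matrix _ _ ℤ) ∧ M * A = D' • (1 : Matrix _ _ ℤ) := by
    rcases lt_or_gt_of_ne hdet with h | h
    · exact ⟨-D, -M.adjugate, by linarith, by simp [adjugate_mul, ← hDdef],
        by simp [mul_adjugate, ← hDdef]⟩
    · exact ⟨D, M.adjugate, h, by simp [adjugate_mul, ← hDdef], by simp [mul_adjugate, ← hDdef]⟩
  have hAMu : ∀ u j, D' * u j = ∑ i, A j i * (M *ᵥ u) i := by
    intro u j
    have : A *ᵥ (M *ᵥ u) = D' • u := by rw [mulVec_mulVec, hAM.1, smul_mulVec, one_mulVec]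
    simpa [mulVec, dotProduct] using (congrFun this j).symm
  -- Column `i` of `A` is a nonzero point on an edge of the cone, so the functional is positive on
  -- it.
  have hα : ∀ i, 1 ≤ g * A 0 i := by
    intro i
    have hcol : M *ᵥ (A *ᵥ Pi.single i 1) = D' • Pi.single i 1 := by
      rw [mulVec_mulVec, hAM.2, smul_mulVec, one_mulVec]
    have h := hpos (A *ᵥ Pi.single i 1) (by
      intro h0
      rw [h0, mulVec_zero] at hcol
      have := congrFun hcol i
      simp at this
      omega) (by
      intro j
      rw [hcol]
      simp only [Pi.smul_apply, smul_eq_mul]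
      exact mul_nonneg hD'.le (by rw [Pi.single_apply]; split_ifs <;> simp))
    simp [Matrix.col_apply] at h
    linarith
  set C : ℤ := ∑ j, ∑ i, |A j i| with hC
  set Λ : ℤ := ∑ i, g * A 0 i with hΛ
  have hC0 : 0 ≤ C := Finset.sum_nonneg fun _ _ => Finset.sum_nonneg fun _ _ => abs_nonneg _
  have hΛ1 : 0 ≤ Λ := Finset.sum_nonneg fun i _ => (by linarith [hα i])
  refine ⟨2 * Λ * C + 2 * C * D' * |F| + C + 1, by positivity, ?_⟩
  intro N hN u hu hF
  obtain ⟨i₀, hi₀⟩ := Finite.exists_max fun i => |(M *ᵥ u) i|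
  set μ := |(M *ᵥ u) i₀| with hμ
  have hμ0 : 0 ≤ μ := abs_nonneg _
  have hub : ∀ j, |u j| ≤ C * μ := by
    intro j
    calc |u j| ≤ D' * |u j| := le_mul_of_one_le_left (abs_nonneg _) hD'
      _ = |∑ i, A j i * (M *ᵥ u) i| := by rw [← hAMu, abs_mul, abs_of_pos hD']
      _ ≤ ∑ i, |A j i * (M *ᵥ u) i| := Finset.abs_sum_le_sum_abs _ _
      _ ≤ ∑ i, |A j i| * μ := Finset.sum_le_sum fun i _ => by
          rw [abs_mul]; exact mul_le_mul_of_nonneg_left (hi₀ i) (abs_nonneg _)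
      _ = (∑ i, |A j i|) * μ := by rw [Finset.sum_mul]
      _ ≤ C * μ := mul_le_mul_of_nonneg_right (Finset.single_le_sum (f := fun j => ∑ i, |A j i|)
          (fun j _ => Finset.sum_nonneg fun _ _ => abs_nonneg _) (Finset.mem_univ j)) hμ0
  clear_value C
  have hlow : ∀ i, -(C * μ) ≤ N * (M *ᵥ u) i := fun i => by
    have := hu i
    have := (abs_le.mp (hub i)).2
    linarith
  have hCF : 0 ≤ C * D' * |F| := by positivity
  have hΛC : 0 ≤ Λ * C := by positivity
  have hNpos : 0 < N := by linarith
  have hNC : C < N := by linarith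
  -- If the largest entry of `M u` in absolute value is negative, `N > C` forces `μ = 0`. Otherwise
  -- the bounded functional, a combination of the entries with weights at least `1`, bounds `μ`
  -- independently of `N`.
  have hμle : μ ≤ 2 * D' * |F| := by
    rcases le_or_gt ((M *ᵥ u) i₀) 0 with h | h
    · have h1 : (M *ᵥ u) i₀ = -μ := by rw [hμ, abs_of_nonpos h]; ring
      have h2 := hlow i₀
      rw [h1] at h2
      have h3 : (N - C) * μ ≤ 0 := by linarith
      have h4 : μ ≤ 0 := by
        by_contra h4
        push Not at h4
        have := mul_pos (sub_pos.mpr hNC) h4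
        linarith
      exact h4.trans (by positivity)
    · have h1 : (M *ᵥ u) i₀ = μ := by rw [hμ, abs_of_pos h]
      have hsum : D' * (g * u 0) = ∑ i, g * A 0 i * (M *ᵥ u) i := by
        rw [mul_left_comm, hAMu, Finset.mul_sum]
        simp only [mul_assoc]
      have key : N * μ - Λ * (C * μ) ≤ N * (D' * (g * u 0)) := by
        have h5 : ∀ i, 0 ≤ g * A 0 i * (N * (M *ᵥ u) i + C * μ) := fun i =>
          mul_nonneg (by linarith [hα i]) (by linarith [hlow i])
        have h6 := Finset.single_le_sum (fun i _ => h5 i) (Finset.mem_univ i₀)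
        have h7 : ∑ i, g * A 0 i * (N * (M *ᵥ u) i + C * μ) =
            N * (D' * (g * u 0)) + Λ * (C * μ) := by
          rw [hsum, hΛ, Finset.mul_sum, Finset.sum_mul, ← Finset.sum_add_distrib]
          exact Finset.sum_congr rfl fun i _ => by ring
        rw [h7, h1] at h6
        have h8 : N * μ + C * μ ≤ g * A 0 i₀ * (N * μ + C * μ) :=
          le_mul_of_one_le_left (by positivity) (hα i₀)
        have : 0 ≤ C * μ := by positivity
        linarith
      have h9 : D' * (g * u 0) ≤ D' * |F| :=
        mul_le_mul_of_nonneg_left (hF.trans (le_abs_self F)) hD'.le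
      have h10 : N * (D' * (g * u 0)) ≤ N * (D' * |F|) := mul_le_mul_of_nonneg_left h9 hNpos.le
      have h11 : 2 * (Λ * (C * μ)) ≤ N * μ := by
        have : (2 * Λ * C) * μ ≤ N * μ := mul_le_mul_of_nonneg_right (by linarith) hμ0
        linarith
      have h12 : N * μ ≤ N * (2 * D' * |F|) := by linarith
      exact le_of_mul_le_mul_left h12 hNpos
  intro i
  by_contra hneg
  push Not at hneg
  have h1 : N * (M *ᵥ u) i ≤ N * (-1) := mul_le_mul_of_nonneg_left (by omega) hNpos.le
  have h2 := hlow i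
  have h3 : C * μ ≤ C * (2 * D' * |F|) := mul_le_mul_of_nonneg_left hμle hC0
  linarith

/-- Modulo `N` the matrix is the identity. -/
theorem isCoprime_det_smul_add_one {n : Type*} [Fintype n] [DecidableEq n] (M : Matrix n n ℤ)
    (N : ℤ) : IsCoprime (N • M + 1).det N := by
  have h : (Ideal.Quotient.mk (Ideal.span {N})) (N • M + 1).det = 1 := by
    rw [RingHom.map_det]
    have hN : (Ideal.Quotient.mk (Ideal.span {N})) N = 0 :=
      Ideal.Quotient.eq_zero_iff_mem.mpr (Ideal.mem_span_singleton_self N)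
    have : (Ideal.Quotient.mk (Ideal.span {N})).mapMatrix (N • M + 1) = 1 := by
      rw [map_add, map_one]
      ext i j
      simp only [RingHom.mapMatrix_apply, Matrix.add_apply, Matrix.map_apply, Matrix.smul_apply,
        smul_eq_mul, map_mul, hN, zero_mul, zero_add]
    rw [this, det_one]
  rw [← map_one (Ideal.Quotient.mk (Ideal.span {N})), Ideal.Quotient.eq,
    Ideal.mem_span_singleton] at h
  obtain ⟨c, hc⟩ := h
  exact ⟨1, -c, by linear_combination hc⟩

theorem AddSubmonoid.mem_closure_range_nat_iff {k : ℕ} (a : Fin k → ℕ) (t : ℕ) :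
    t ∈ AddSubmonoid.closure (Set.range a) ↔ ∃ x : Fin k → ℕ, ∑ i, x i * a i = t := by
  rw [← Submodule.span_nat_eq_addSubmonoidClosure, Submodule.mem_toAddSubmonoid,
    Submodule.mem_span_range_iff_exists_fun]
  simp

/-! ### From a simplicial cone to a quotient -/

open Module in
/-- A numerical semigroup of the values of `τ` on the lattice points of the cone `{ℓ ≥ 0}`, all of
whose generators are values at interior points, is a quotient. -/
theorem NumericalSemigroup.isQuotient_of_forms {r : ℕ} {V : Type*} [AddCommGroup V]
    [Module.Free ℤ V] [Module.Finite ℤ V] (hV : finrank ℤ V = r + 1)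
    (ℓ : Fin (r + 1) → V →ₗ[ℤ] ℤ) (τ : V →ₗ[ℤ] ℤ) (S : NumericalSemigroup) (T : Finset ℕ)
    (hT : AddSubmonoid.closure (T : Set ℕ) = S) (F : ℤ) (hF : 0 ≤ F)
    (hpos : ∀ v, v ≠ 0 → (∀ i, 0 ≤ ℓ i v) → 0 < τ v)
    (hmem : ∀ v, (F ≤ τ v ∨ ∀ i, 0 ≤ ℓ i v) → ∃ s ∈ S, τ v = (s : ℤ))
    (hint : ∀ s ∈ T, s ≠ 0 → ∃ v, τ v = s ∧ ∀ i, 0 < ℓ i v) : S.IsQuotient (r + 1) := by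
  -- Where all forms but the last vanish, `v` or `-v` lies in the cone, and `τ` vanishes there only
  -- at `0`.
  have hinj : ∀ v, (∀ i, (Fin.cons τ (fun i : Fin r => ℓ i.castSucc) : Fin (r + 1) → V →ₗ[ℤ] ℤ) i v
      = 0) → v = 0 := by
    intro v hv
    have h0 : τ v = 0 := hv 0
    have h1 : ∀ i : Fin r, ℓ i.castSucc v = 0 := fun i => hv i.succ
    by_contra hne
    rcases le_total 0 (ℓ (Fin.last r) v) with h | h
    · have := hpos v hne (fun i => Fin.lastCases h (fun i => (h1 i).ge) i)
      omega
    · have := hpos (-v) (neg_ne_zero.mpr hne)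
        (fun i => Fin.lastCases (by simpa using h) (fun i => by simp [h1 i]) i)
      rw [map_neg] at this
      omega
  obtain ⟨b, hb, hb'⟩ := exists_basis_triangular (r + 1) hV _ hinj
  set g := τ (b 0) with hg
  have hg0 : g ≠ 0 := hb' 0
  set M : Matrix (Fin (r + 1)) (Fin (r + 1)) ℤ := Matrix.of fun i j => ℓ i (b j) with hM
  have hℓ : ∀ u i, ℓ i (b.equivFun.symm u) = (M *ᵥ u) i := by
    intro u i
    simp [Basis.equivFun_symm_apply, mulVec, dotProduct, hM, mul_comm]
  have hτ : ∀ u, τ (b.equivFun.symm u) = g * u 0 := by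
    intro u
    have h0 : ∀ j : Fin r, τ (b j.succ) = 0 := fun j => hb 0 j.succ (Fin.succ_pos j)
    simp [Basis.equivFun_symm_apply, Fin.sum_univ_succ, h0, hg, mul_comm]
  have hpos' : ∀ u, u ≠ 0 → (∀ i, 0 ≤ (M *ᵥ u) i) → 0 < g * u 0 := by
    intro u hu h
    rw [← hτ]
    exact hpos _ (by rwa [Ne, LinearEquiv.map_eq_zero_iff]) (fun i => by rw [hℓ]; exact h i)
  obtain ⟨N₀, -, hN₀⟩ := nonneg_of_perturbed_nonneg M g F hpos'
  have hgen : ∀ᶠ N : ℤ in Filter.atTop, ∀ s ∈ T, ∃ u, g * u 0 = s ∧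
      ∀ i, 0 ≤ N * (M *ᵥ u) i + u i := by
    rw [Filter.eventually_all_finset]
    intro s hs
    by_cases h0 : s = 0
    · exact Filter.Eventually.of_forall fun N => ⟨0, by simp [h0], by simp⟩
    · obtain ⟨v, hv, hv'⟩ := hint s hs h0
      obtain ⟨u, rfl⟩ := b.equivFun.symm.surjective v
      filter_upwards [Filter.eventually_ge_atTop (∑ i, |u i|)] with N hN
      refine ⟨u, by rw [← hτ, hv], fun i => ?_⟩
      have h1 : |u i| ≤ N := (Finset.single_le_sum (f := fun i => |u i|)
        (fun i _ => abs_nonneg _) (Finset.mem_univ i)).trans hN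
      have h2 := hv' i
      rw [hℓ] at h2
      have h3 : N ≤ N * (M *ᵥ u) i :=
        le_mul_of_one_le_right ((abs_nonneg _).trans h1) h2
      have := (abs_le.mp h1).1
      linarith
  obtain ⟨N₁, hN₁⟩ := Filter.eventually_atTop.mp hgen
  have hdiag : ∀ i : Fin r, M i.castSucc i.succ ≠ 0 := fun i => hb' i.succ
  -- Making `N` a multiple of `P` makes `g` and all the triangular diagonal entries prime to `D`.
  set P : ℤ := |g * ∏ i : Fin r, M i.castSucc i.succ| with hP
  have hP1 : 1 ≤ P := Int.one_le_abs (mul_ne_zero hg0 (Finset.prod_ne_zero_iff.mpr fun i _ => hdiag i))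
  obtain ⟨N, hPN, hN0, hN1, hN2⟩ : ∃ N : ℤ, P ∣ N ∧ N₀ ≤ N ∧ N₁ ≤ N ∧ 2 ≤ N := by
    refine ⟨P * max N₀ (max N₁ 2), dvd_mul_right _ _, ?_⟩
    have h2 : max N₀ (max N₁ 2) ≤ P * max N₀ (max N₁ 2) :=
      le_mul_of_one_le_left (by simp) hP1
    refine ⟨(le_max_left _ _).trans h2, ?_, ?_⟩
    · exact ((le_max_left _ _).trans (le_max_right _ _)).trans h2
    · exact ((le_max_right _ _).trans (le_max_right _ _)).trans h2
  have hgN : g ∣ N := ((dvd_mul_right g _).trans ((dvd_abs _ _).mpr dvd_rfl)).trans hPN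
  have hTN : ∀ i : Fin r, M i.castSucc i.succ ∣ N := fun i =>
    (((Finset.dvd_prod_of_mem _ (Finset.mem_univ i)).trans (dvd_mul_left _ g)).trans
      ((dvd_abs _ _).mpr dvd_rfl)).trans hPN
  set M' := N • M + 1 with hM'
  have hM'u : ∀ u i, (M' *ᵥ u) i = N * (M *ᵥ u) i + u i := by
    intro u i
    rw [hM', add_mulVec, smul_mulVec, one_mulVec]
    rfl
  have hcop : IsCoprime M'.det N := isCoprime_det_smul_add_one M N
  set D := M'.det with hD
  have hD0 : D ≠ 0 := by
    intro h
    rw [h, isCoprime_zero_left] at hcop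
    rcases Int.isUnit_iff.mp hcop with h | h <;> omega
  -- Deleting the last row and first column moves the identity's ones strictly below the diagonal,
  -- so they do not enter the determinant.
  have hminor : (M'.submatrix Fin.castSucc Fin.succ).det =
      ∏ i : Fin r, N * M i.castSucc i.succ := by
    rw [det_of_isLowerTriangular]
    · refine Finset.prod_congr rfl fun i _ => ?_
      have : i.castSucc ≠ i.succ := (Fin.castSucc_lt_succ (i := i)).ne
      rw [submatrix_apply, hM', Matrix.add_apply, Matrix.smul_apply, one_apply_ne this, add_zero,
        smul_eq_mul]
    · intro i j hij
      have hij : i < j := hij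
      have h1 : i.castSucc ≠ j.succ := by
        intro h
        have := congrArg Fin.val h
        simp at this
        omega
      have h2 : M i.castSucc j.succ = 0 := hb i.succ j.succ (Fin.succ_lt_succ_iff.mpr hij)
      rw [submatrix_apply, hM', Matrix.add_apply, Matrix.smul_apply, one_apply_ne h1, add_zero, h2,
        smul_zero]
  have hcop' : IsCoprime D (M'.submatrix Fin.castSucc Fin.succ).det := by
    rw [hminor]
    exact IsCoprime.prod_right fun i _ =>
      hcop.mul_right (hcop.of_isCoprime_of_dvd_right (hTN i))
  have hadj : ∀ u, (M'.adjugate *ᵥ (M' *ᵥ u)) 0 = D * u 0 := by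
    intro u
    rw [mulVec_mulVec, adjugate_mul, smul_mulVec, one_mulVec]
    simp [hD]
  have hsD : D.sign * D = D.natAbs := by rw [Int.sign_mul_self_eq_natAbs]
  have hsD' : D.sign * D.sign = 1 := by
    rcases lt_or_gt_of_ne hD0 with h | h
    · simp [Int.sign_eq_neg_one_of_neg h]
    · simp [Int.sign_eq_one_of_pos h]
  -- By Cramer's rule, `∑ x_i a_i = |D| g u₀` when `x = M' u`.
  set a : Fin (r + 1) → ℤ := fun i => D.sign * (g * M'.adjugate 0 i) with ha
  have hapos : ∀ i, 0 < a i := by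
    intro i
    set u := D.sign • (M'.adjugate *ᵥ Pi.single i 1) with hu
    have hMu : M' *ᵥ u = (D.natAbs : ℤ) • Pi.single i 1 := by
      rw [hu, mulVec_smul, mulVec_mulVec, mul_adjugate, smul_mulVec, one_mulVec, smul_smul, ← hD,
        hsD]
    have hau : a i = g * u 0 := by
      simp [ha, hu, Matrix.col_apply]
      ring
    by_contra hneg
    -- If `a i ≤ 0 ≤ F`, the edge vector `u` would lie in the unperturbed cone, where the functional
    -- is positive.
    push Not at hneg
    have h1 := hN₀ N hN0 u (fun j => by
      rw [← hM'u, hMu]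
      simp only [Pi.smul_apply, smul_eq_mul]
      exact mul_nonneg (Int.natCast_nonneg _) (by rw [Pi.single_apply]; split_ifs <;> simp))
      (by omega)
    have h2 := hpos' u (by
      intro h0
      rw [h0, mulVec_zero] at hMu
      have := congrFun hMu i
      simp at this
      exact hD0 (by simpa using this.symm)) h1
    omega
  have hsum : ∀ x : Fin (r + 1) → ℤ, ∑ i, x i * a i = D.sign * (g * (M'.adjugate *ᵥ x) 0) := by
    intro x
    simp only [mulVec, dotProduct, Finset.mul_sum, ha]
    exact Finset.sum_congr rfl fun i _ => by ring
  refine ⟨D.natAbs, fun i => (a i).toNat, Int.natAbs_pos.mpr hD0,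
    fun i => Int.lt_toNat.mpr (by simpa using hapos i), ?_⟩
  have htoNat : ∀ i, ((a i).toNat : ℤ) = a i := fun i => Int.toNat_of_nonneg (hapos i).le
  apply le_antisymm
  · rw [← hT, AddSubmonoid.closure_le]
    intro s hs
    change D.natAbs * s ∈ AddSubmonoid.closure _
    rw [AddSubmonoid.mem_closure_range_nat_iff]
    obtain ⟨u, hus, hu⟩ := hN₁ N hN1 s hs
    refine ⟨fun i => ((M' *ᵥ u) i).toNat, ?_⟩
    zify
    have : ∀ i, (((M' *ᵥ u) i).toNat : ℤ) = (M' *ᵥ u) i := fun i =>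
      Int.toNat_of_nonneg (by rw [hM'u]; exact hu i)
    simp only [htoNat, this]
    rw [hsum, hadj, ← hus, Int.abs_eq_natAbs, ← hsD]
    ring
  · intro t ht
    change D.natAbs * t ∈ AddSubmonoid.closure _ at ht
    rw [AddSubmonoid.mem_closure_range_nat_iff] at ht
    obtain ⟨x, hx⟩ := ht
    zify at hx
    simp only [htoNat] at hx
    rw [hsum (fun i => (x i : ℤ)), Int.abs_eq_natAbs, ← hsD] at hx
    have hx' : D * t = g * (M'.adjugate *ᵥ fun i => (x i : ℤ)) 0 := by
      have := congrArg (D.sign * ·) hx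
      linear_combination (-1 : ℤ) * this + (D * t - g * (M'.adjugate *ᵥ fun i => (x i : ℤ)) 0) * (-hsD')
    obtain ⟨t', ht'⟩ : g ∣ (t : ℤ) :=
      (hcop.of_isCoprime_of_dvd_right hgN).symm.dvd_of_dvd_mul_left ⟨_, hx'⟩
    have hDt : (M'.adjugate *ᵥ fun i => (x i : ℤ)) 0 = D * t' := by
      apply mul_left_cancel₀ hg0
      rw [← hx', ht']
      ring
    obtain ⟨u, hu⟩ := exists_mulVec_eq_of_det_dvd M' hD0 hcop' _ ⟨t', hDt⟩
    have hut : u 0 = t' := by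
      apply mul_left_cancel₀ hD0
      rw [← hadj, hu, hDt]
    have htu : g * u 0 = t := by rw [hut, ht']
    obtain ⟨s, hs, hst⟩ := hmem (b.equivFun.symm u) (by
      rw [hτ]
      by_cases hFt : F ≤ g * u 0
      · exact Or.inl hFt
      · refine Or.inr fun i => ?_
        rw [hℓ]
        refine hN₀ N hN0 u (fun j => ?_) (by omega) i
        rw [← hM'u, hu]
        exact Int.natCast_nonneg _)
    rw [hτ, htu] at hst
    have : t = s := by exact_mod_cast hst
    rwa [this]

/-! ### Making the cone simplicial and the generators interior -/

namespace NumericalSemigroup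

open Module in
/-- A numerical semigroup of the values of `π` on the points `z` of `ℤᵐ` such that `n z` is a
nonnegative integral combination of `v₁, …, v_k` is a `k`-quotient. -/
theorem isQuotient_of_rational_cone {k m : ℕ} (v : Fin k → Fin m → ℤ) (π : (Fin m → ℤ) →ₗ[ℤ] ℤ)
    (n : ℤ) (hn : 0 < n) (hπ : ∀ i, 0 ≤ π (v i)) (S : NumericalSemigroup) (hS : S ≠ ⊥)
    (T : Finset ℕ) (hT : AddSubmonoid.closure (T : Set ℕ) = S)
    (hmem : ∀ (x : Fin k → ℤ) (z : Fin m → ℤ), (∀ i, 0 ≤ x i) → ∑ i, x i • v i = n • z →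
      ∃ s ∈ S, π z = (s : ℤ))
    (hgen : ∀ s ∈ T, ∃ (x : Fin k → ℤ) (z : Fin m → ℤ), (∀ i, 0 ≤ x i) ∧
      ∑ i, x i • v i = n • z ∧ π z = s) : S.IsQuotient k := by
  set Φ : ((Fin k → ℤ) × (Fin m → ℤ)) →ₗ[ℤ] (Fin m → ℤ) :=
    (Fintype.linearCombination ℤ v).comp (LinearMap.fst ℤ _ _) - n • LinearMap.snd ℤ _ _ with hΦ
  set V := LinearMap.ker Φ with hV
  have hVmem : ∀ w : (Fin k → ℤ) × (Fin m → ℤ), w ∈ V ↔ ∑ i, w.1 i • v i = n • w.2 := by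
    intro w
    rw [hV, LinearMap.mem_ker, hΦ, LinearMap.sub_apply, sub_eq_zero]
    rfl
  have hβ : ∀ w : (Fin k → ℤ) × (Fin m → ℤ), w ∈ V → ∑ i, π (v i) * w.1 i = n * π w.2 := by
    intro w hw
    have := congrArg π ((hVmem w).mp hw)
    simp only [map_sum, map_smul, smul_eq_mul] at this
    rw [← this]
    exact Finset.sum_congr rfl fun i _ => mul_comm _ _
  have hinj : Function.Injective ((LinearMap.fst ℤ (Fin k → ℤ) (Fin m → ℤ)).comp V.subtype) := by
    rw [← LinearMap.ker_eq_bot, LinearMap.ker_eq_bot']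
    rintro ⟨⟨x, z⟩, hw⟩ hx
    have hx : x = 0 := hx
    subst hx
    have := (hVmem _).mp hw
    simp only [Pi.zero_apply, zero_smul, Finset.sum_const_zero] at this
    have hz : z = 0 := by
      rcases smul_eq_zero.mp this.symm with h | h
      · exact absurd h hn.ne'
      · exact h
    simp [hz]
  have hrank : finrank ℤ V = k := by
    apply le_antisymm
    · simpa using LinearMap.finrank_le_finrank_of_injective hinj
    · have : Function.Injective (LinearMap.codRestrict V
          (LinearMap.prod (n • LinearMap.id) (Fintype.linearCombination ℤ v)) (by
            intro x
            rw [hVmem]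
            change ∑ i, (n * x i) • v i = n • ∑ i, x i • v i
            simp only [Finset.smul_sum, mul_smul])) := by
        rw [LinearMap.injective_codRestrict_iff]
        intro x y hxy
        exact smul_right_injective _ hn.ne' (congrArg Prod.fst hxy)
      simpa using LinearMap.finrank_le_finrank_of_injective this
  have hBpos : 0 < ∑ i, π (v i) := by
    refine lt_of_le_of_ne (Finset.sum_nonneg fun i _ => hπ i) fun h => hS ?_
    have h0 := (Finset.sum_eq_zero_iff_of_nonneg fun i _ => hπ i).mp h.symm
    rw [← hT, eq_bot_iff, AddSubmonoid.closure_le]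
    intro s hs
    obtain ⟨x, z, -, hxz, hz⟩ := hgen s hs
    have := hβ (x, z) ((hVmem _).mpr hxz)
    rw [Finset.sum_eq_zero fun i hi => by rw [h0 i hi, zero_mul], hz] at this
    rcases mul_eq_zero.mp this.symm with h | h
    · exact absurd h hn.ne'
    · exact AddSubmonoid.mem_bot.mpr (by exact_mod_cast h)
  obtain ⟨r, rfl⟩ : ∃ r, k = r + 1 := by
    cases k with
    | zero => simp at hBpos
    | succ r => exact ⟨r, rfl⟩
  -- Adding a multiple of `(n, …, n; ∑ v_i)` moves any lattice point into the cone.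
  have hgcd : ∀ w ∈ V, (Nat.setGcd (S : Set ℕ) : ℤ) ∣ π w.2 := by
    have hdvd : ∀ (x : Fin (r + 1) → ℤ) (z : Fin m → ℤ), (∀ i, 0 ≤ x i) →
        ∑ i, x i • v i = n • z → (Nat.setGcd (S : Set ℕ) : ℤ) ∣ π z := by
      intro x z hx hxz
      obtain ⟨s, hs, hsz⟩ := hmem x z hx hxz
      rw [hsz]
      exact_mod_cast Nat.setGcd_dvd_of_mem hs
    rintro ⟨x, z⟩ hw
    rw [hVmem] at hw
    have h1 := hdvd (fun _ => n) (∑ i, v i) (fun _ => hn.le) (by rw [Finset.smul_sum])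
    have h2 := hdvd (fun i => x i + n * ∑ i, |x i|) (z + (∑ i, |x i|) • ∑ i, v i) (fun i => by
      have h3 : |x i| ≤ ∑ i, |x i| := Finset.single_le_sum (f := fun i => |x i|)
        (fun i _ => abs_nonneg _) (Finset.mem_univ i)
      have h4 : ∑ i, |x i| ≤ n * ∑ i, |x i| :=
        le_mul_of_one_le_left ((abs_nonneg _).trans h3) hn
      have := neg_abs_le (x i)
      linarith) (by
      simp only [add_smul, Finset.sum_add_distrib, hw, smul_add, mul_smul, Finset.smul_sum])
    rw [map_add, map_smul, smul_eq_mul] at h2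
    exact (dvd_add_left (h1.mul_left _)).mp h2
  obtain ⟨F, hF⟩ := Nat.exists_mem_closure_of_ge (S : Set ℕ)
  rw [AddSubmonoid.closure_eq] at hF
  -- `E` is chosen so large that `n E τ - σ` is positive at the lifts of the nonzero generators.
  have hev : ∀ᶠ E : ℤ in Filter.atTop, ∀ s ∈ T, s ≠ 0 → ∃ (x : Fin (r + 1) → ℤ) (z : Fin m → ℤ),
      (∀ i, 0 ≤ x i) ∧ ∑ i, x i • v i = n • z ∧ π z = s ∧ ∑ i, x i < E * (n * π z) := by
    rw [Filter.eventually_all_finset]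
    intro s hs
    obtain ⟨x, z, hx, hxz, hz⟩ := hgen s hs
    filter_upwards [Filter.eventually_ge_atTop (∑ i, x i + 1)] with E hE h0
    refine ⟨x, z, hx, hxz, hz, ?_⟩
    have h1 : 1 ≤ n * π z := by
      rw [hz]
      exact mul_pos hn (by omega)
    have h2 : 0 ≤ ∑ i, x i := Finset.sum_nonneg fun i _ => hx i
    have h3 : E ≤ E * (n * π z) := le_mul_of_one_le_right (by omega) h1
    omega
  obtain ⟨E, hE0, hE⟩ := (hev.and (Filter.eventually_ge_atTop 1)).exists.imp
    fun _ h => And.symm h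
  set K : ℤ := r + 1 with hK
  set G : ℤ := n * E * F with hG
  have hG0 : 0 ≤ G := by positivity
  -- If `τ ≤ F`, summing the inequalities `ℓ i ≥ 0` gives `σ ≥ -K G`; then `x_i ≤ -1` would give `ℓ
  -- i ≤ -c + G + K G < 0`.
  set c : ℤ := K + (K + 1) * G + 1 with hc
  have hcK : 1 ≤ c - K := by
    have : 0 ≤ (K + 1) * G := by positivity
    omega
  have hc0 : 0 < c := by omega
  set σ : (Fin (r + 1) → ℤ) → ℤ := fun x => ∑ i, x i with hσ
  set ℓ : Fin (r + 1) → V →ₗ[ℤ] ℤ := fun i =>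
    (c • (LinearMap.proj i).comp (LinearMap.fst ℤ _ _) + (n * E) • π.comp (LinearMap.snd ℤ _ _) -
      (∑ j, LinearMap.proj j).comp (LinearMap.fst ℤ (Fin (r + 1) → ℤ) (Fin m → ℤ))).comp
        V.subtype with hℓdef
  have hℓ : ∀ i (w : V), ℓ i w = c * w.1.1 i + n * E * π w.1.2 - σ w.1.1 := by
    intro i w
    simp [hℓdef, hσ]
  have hsum : ∀ w : V, (∀ i, 0 ≤ ℓ i w) → 0 ≤ (c - K) * σ w.1.1 + K * (n * E * π w.1.2) := by
    intro w hw
    have h1 := Finset.sum_nonneg (s := Finset.univ) fun i _ => hw i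
    have h2 : ∑ i, ℓ i w = (c - K) * σ w.1.1 + K * (n * E * π w.1.2) := by
      simp only [hℓ, Finset.sum_sub_distrib, Finset.sum_add_distrib, ← Finset.mul_sum,
        Finset.sum_const, Finset.card_univ, Fintype.card_fin, nsmul_eq_mul]
      push_cast
      rw [← hK]
      change c * σ w.1.1 + _ - _ = _
      ring
    rwa [h2] at h1
  have hpos : ∀ w : V, w ≠ 0 → (∀ i, 0 ≤ ℓ i w) → 0 < π w.1.2 := by
    intro w hw0 hw
    by_contra hp
    push Not at hp
    have h1 := hsum w hw
    have hnE : 0 < n * E := by positivity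
    have hσ0 : 0 ≤ σ w.1.1 := by
      have h2 : K * (n * E * π w.1.2) ≤ 0 := mul_nonpos_of_nonneg_of_nonpos (by positivity)
        (mul_nonpos_of_nonneg_of_nonpos hnE.le hp)
      have h3 : 0 ≤ (c - K) * σ w.1.1 := by linarith
      exact nonneg_of_mul_nonneg_right h3 (by linarith)
    -- The `ℓ i` are summed with weights `π (v i)`, which turns `∑ π (v i) x_i` into `n τ`.
    have h4 : 0 ≤ c * (n * π w.1.2) + (∑ i, π (v i)) * (n * E * π w.1.2 - σ w.1.1) := by
      have h5 := Finset.sum_nonneg (s := Finset.univ) fun i _ => mul_nonneg (hπ i) (hw i)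
      rw [← hβ w.1 w.2, Finset.mul_sum, Finset.sum_mul, ← Finset.sum_add_distrib]
      convert! h5 using 2 with i
      rw [hℓ]
      ring
    have h6 : (∑ i, π (v i)) * σ w.1.1 ≤ (c * n + (∑ i, π (v i)) * (n * E)) * π w.1.2 := by
      linarith
    have h7 : 0 < c * n + (∑ i, π (v i)) * (n * E) := by positivity
    have h8 : 0 ≤ (∑ i, π (v i)) * σ w.1.1 := by positivity
    have hp0 : π w.1.2 = 0 := le_antisymm hp (nonneg_of_mul_nonneg_right (h8.trans h6) h7)
    rw [hp0, mul_zero] at h6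
    have hσ00 : σ w.1.1 = 0 := le_antisymm (nonpos_of_mul_nonpos_right h6 hBpos) hσ0
    have hx : ∀ i, 0 ≤ w.1.1 i := by
      intro i
      have := hw i
      rw [hℓ, hp0, hσ00, mul_zero, add_zero, sub_zero] at this
      exact nonneg_of_mul_nonneg_right this hc0
    have hx0 : w.1.1 = 0 := funext fun i =>
      (Finset.sum_eq_zero_iff_of_nonneg fun i _ => hx i).mp hσ00 i (Finset.mem_univ i)
    exact hw0 (hinj (by simpa using hx0))
  refine isQuotient_of_forms hrank ℓ (π.comp ((LinearMap.snd ℤ _ _).comp V.subtype)) S T hT F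
    (Int.natCast_nonneg F) hpos ?_ ?_
  · intro w hw
    change F ≤ π w.1.2 ∨ _ at hw
    change ∃ s ∈ S, π w.1.2 = _
    by_cases hFw : F ≤ π w.1.2
    · have h0 : ((π w.1.2).toNat : ℤ) = π w.1.2 := Int.toNat_of_nonneg (by omega)
      refine ⟨(π w.1.2).toNat, hF _ (by omega) ?_, h0.symm⟩
      zify
      rw [Int.toNat_of_nonneg (by omega)]
      exact hgcd w.1 w.2
    · have hw := hw.resolve_left hFw
      have hp0 : 0 ≤ π w.1.2 := by
        by_cases h0 : w = 0
        · simp [h0]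
        · exact (hpos w h0 hw).le
      refine hmem w.1.1 w.1.2 (fun i => ?_) ((hVmem _).mp w.2)
      have hpG : n * E * π w.1.2 ≤ G := mul_le_mul_of_nonneg_left (by omega) (by positivity)
      have h1 := hsum w hw
      have h2 : K * (n * E * π w.1.2) ≤ K * G := mul_le_mul_of_nonneg_left hpG (by positivity)
      have h3 : -(K * G) ≤ σ w.1.1 := by
        by_contra h
        push Not at h
        have hKG : 0 ≤ K * G := by positivity
        have h4 : (c - K) * σ w.1.1 ≤ 1 * σ w.1.1 :=
          mul_le_mul_of_nonpos_right hcK (by linarith)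
        linarith
      have h5 := hw i
      rw [hℓ] at h5
      by_contra hneg
      push Not at hneg
      have h6 : c * w.1.1 i ≤ c * (-1) := mul_le_mul_of_nonneg_left (by omega) hc0.le
      have hK0 : 0 < K := by positivity
      linarith
  · intro s hs h0
    obtain ⟨x, z, hx, hxz, hz, hlt⟩ := hE s hs h0
    refine ⟨⟨(x, z), (hVmem _).mpr hxz⟩, hz, fun i => ?_⟩
    rw [hℓ]
    change 0 < c * x i + n * E * π z - ∑ i, x i
    have : 0 ≤ c * x i := mul_nonneg hc0.le (hx i)
    linarith

end NumericalSemigroup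

/-! ### Extreme rays and minimal generators -/

section Cone

variable {E : Type*} [AddCommGroup E] [Module ℝ E]

theorem PointedCone.mem_hull_range_iff {ι : Type*} [Fintype ι] {v : ι → E} {x : E} :
    x ∈ PointedCone.hull ℝ (Set.range v) ↔ ∃ c : ι → ℝ, (∀ i, 0 ≤ c i) ∧ ∑ i, c i • v i = x := by
  rw [PointedCone.hull, Submodule.mem_span_range_iff_exists_fun]
  constructor
  · rintro ⟨c, rfl⟩
    exact ⟨fun i => c i, fun i => (c i).2, rfl⟩
  · rintro ⟨c, hc, rfl⟩
    exact ⟨fun i => ⟨c i, hc i⟩, rfl⟩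

theorem PointedCone.exists_minimal_hull_eq {V : Set E} (hV : V.Finite) :
    ∃ W ⊆ V, PointedCone.hull ℝ W = PointedCone.hull ℝ V ∧
      ∀ v ∈ W, v ∉ PointedCone.hull ℝ (W \ {v}) := by
  have hfin : {W | W ⊆ V ∧ PointedCone.hull ℝ W = PointedCone.hull ℝ V}.Finite :=
    hV.finite_subsets.subset fun W hW => hW.1
  obtain ⟨W, hW⟩ := hfin.exists_minimal ⟨V, subset_rfl, rfl⟩
  refine ⟨W, hW.prop.1, hW.prop.2, fun v hv hmem => ?_⟩
  have h1 : PointedCone.hull ℝ (W \ {v}) = PointedCone.hull ℝ W := by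
    apply le_antisymm (Submodule.span_mono Set.sdiff_subset)
    refine Submodule.span_le.mpr fun w hw => ?_
    by_cases h : w = v
    · rw [h]; exact hmem
    · exact Submodule.subset_span ⟨hw, h⟩
  have h2 := hW.le_of_le ⟨Set.sdiff_subset.trans hW.prop.1, h1.trans hW.prop.2⟩ Set.sdiff_subset
  exact (h2 hv).2 rfl

theorem PointedCone.exists_eq_smul_add_of_mem_hull {V : Set E} {v x : E} (hv : v ∈ V)
    (hx : x ∈ PointedCone.hull ℝ V) :
    ∃ a : ℝ, 0 ≤ a ∧ ∃ y ∈ PointedCone.hull ℝ (V \ {v}), x = a • v + y := by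
  rw [← Set.insert_sdiff_self_of_mem hv, PointedCone.hull, Submodule.mem_span_insert] at hx
  obtain ⟨a, y, hy, rfl⟩ := hx
  exact ⟨a, a.2, y, hy, rfl⟩

theorem PointedCone.mem_hull_singleton {v x : E} :
    x ∈ PointedCone.hull ℝ {v} ↔ ∃ a : ℝ, 0 ≤ a ∧ a • v = x := by
  rw [PointedCone.hull, Submodule.mem_span_singleton]
  exact ⟨fun ⟨a, ha⟩ => ⟨a, a.2, ha⟩, fun ⟨a, h0, ha⟩ => ⟨⟨a, h0⟩, ha⟩⟩

/-- When a sum of points of the cone lies in a face, so does each summand. -/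
theorem PointedCone.IsFaceOf.mem_hull_inter {F : PointedCone ℝ E} {V : Set E}
    (hF : F.IsFaceOf (PointedCone.hull ℝ V)) {x : E} (hx : x ∈ F) :
    x ∈ PointedCone.hull ℝ (V ∩ F) := by
  have hxV := hF.le hx
  induction hxV using Submodule.span_induction with
  | mem x h => exact Submodule.subset_span ⟨h, hx⟩
  | zero => exact zero_mem _
  | add x y hx' hy' ihx ihy =>
    exact add_mem (ihx (hF.mem_of_add_mem_left hx' hy' hx)) (ihy (hF.mem_of_add_mem_right hx' hy' hx))
  | smul a x hx' ih =>
    by_cases ha : a = 0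
    · rw [ha, zero_smul]
      exact zero_mem _
    · refine Submodule.smul_mem _ a (ih ?_)
      have := Submodule.smul_mem F a⁻¹ hx
      rwa [smul_smul, inv_mul_cancel₀ ha, one_smul] at this

theorem PointedCone.isFaceOf_hull_singleton {V : Set E}
    (hsal : (PointedCone.hull ℝ V : ConvexCone ℝ E).Salient) {v : E} (hv : v ∈ V)
    (hmin : v ∉ PointedCone.hull ℝ (V \ {v})) :
    (PointedCone.hull ℝ {v}).IsFaceOf (PointedCone.hull ℝ V) := by
  have hle : PointedCone.hull ℝ (V \ {v}) ≤ PointedCone.hull ℝ V :=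
    Submodule.span_mono Set.sdiff_subset
  have hvV : v ∈ PointedCone.hull ℝ V := Submodule.subset_span hv
  refine ⟨Submodule.span_mono (Set.singleton_subset_iff.mpr hv), ?_⟩
  intro x y a hx hy ha hxy
  obtain ⟨b, hb, x', hx', rfl⟩ := exists_eq_smul_add_of_mem_hull hv hx
  obtain ⟨c, hc, y', hy', rfl⟩ := exists_eq_smul_add_of_mem_hull hv hy
  obtain ⟨e, he, hxy⟩ := mem_hull_singleton.mp hxy
  have hax' : a • x' ∈ PointedCone.hull ℝ (V \ {v}) := PointedCone.smul_mem _ ha.le hx'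
  have key : (e - (a * b + c)) • v = a • x' + y' := by
    rw [sub_smul, hxy]
    module
  -- A positive coefficient would put `v` in the hull of the other generators; otherwise `-(a • x')`
  -- lies in the cone, and salience kills `x'`.
  rcases lt_or_ge 0 (e - (a * b + c)) with hpos | hneg
  · refine absurd ?_ hmin
    have : v = (e - (a * b + c))⁻¹ • (a • x' + y') := by
      rw [← key, smul_smul, inv_mul_cancel₀ hpos.ne', one_smul]
    have hmem : (e - (a * b + c))⁻¹ • (a • x' + y') ∈ PointedCone.hull ℝ (V \ {v}) :=
      PointedCone.smul_mem _ (inv_nonneg.mpr hpos.le) (add_mem hax' hy')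
    rwa [← this] at hmem
  · have hx0 : a • x' = 0 := by
      by_contra hne
      refine hsal (a • x') (hle hax') hne ?_
      have : -(a • x') = y' + (-(e - (a * b + c))) • v := by
        rw [neg_smul, key]
        abel
      rw [this]
      exact add_mem (hle hy') (PointedCone.smul_mem _ (neg_nonneg.mpr hneg) hvV)
    have hx0' : x' = 0 := (smul_eq_zero.mp hx0).resolve_left ha.ne'
    rw [hx0', add_zero]
    exact mem_hull_singleton.mpr ⟨b, hb, rfl⟩

end Cone

/-- The extreme rays of a salient cone correspond to any minimal set of generators. -/
theorem encard_extremeRays_hull {m : ℕ} {V : Set (Fin m → ℝ)}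
    (hsal : (PointedCone.hull ℝ V : ConvexCone ℝ (Fin m → ℝ)).Salient)
    (hmin : ∀ v ∈ V, v ∉ PointedCone.hull ℝ (V \ {v})) :
    (extremeRays (PointedCone.hull ℝ V)).encard = V.encard := by
  have hne : ∀ v ∈ V, v ≠ 0 := fun v hv h => hmin v hv (by rw [h]; exact zero_mem _)
  have himage : extremeRays (PointedCone.hull ℝ V) = (fun v => PointedCone.hull ℝ {v}) '' V := by
    ext F
    constructor
    · rintro ⟨hF, w, hw, rfl⟩
      have hwF : w ∈ PointedCone.hull ℝ {w} := Submodule.subset_span rfl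
      have hw' := hF.mem_hull_inter hwF
      have hnonempty : (V ∩ (PointedCone.hull ℝ {w} : Set (Fin m → ℝ))).Nonempty := by
        rw [Set.nonempty_iff_ne_empty]
        intro h
        rw [h, PointedCone.hull, Submodule.span_empty, Submodule.mem_bot] at hw'
        exact hw hw'
      obtain ⟨v, hv, hvF⟩ := hnonempty
      refine ⟨v, hv, ?_⟩
      obtain ⟨a, ha, rfl⟩ := PointedCone.mem_hull_singleton.mp hvF
      have ha0 : a ≠ 0 := by
        rintro rfl
        exact hne _ hv (zero_smul _ _)
      apply le_antisymm
      · rw [PointedCone.hull, Submodule.span_le, Set.singleton_subset_iff]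
        exact hvF
      · rw [PointedCone.hull, Submodule.span_le, Set.singleton_subset_iff]
        exact PointedCone.mem_hull_singleton.mpr ⟨a⁻¹, inv_nonneg.mpr ha, by
          rw [smul_smul, inv_mul_cancel₀ ha0, one_smul]⟩
    · rintro ⟨v, hv, rfl⟩
      exact ⟨PointedCone.isFaceOf_hull_singleton hsal hv (hmin v hv), v, hne v hv, rfl⟩
  rw [himage]
  refine Set.InjOn.encard_image fun v hv w hw hvw => ?_
  by_contra h
  have hvw : PointedCone.hull ℝ {v} = PointedCone.hull ℝ {w} := hvw
  have hmem : v ∈ PointedCone.hull ℝ {w} := by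
    rw [← hvw]
    exact Submodule.subset_span rfl
  have hsub : ({w} : Set (Fin m → ℝ)) ⊆ V \ {v} :=
    Set.singleton_subset_iff.mpr ⟨hw, fun h' => h h'.symm⟩
  exact hmin v hv (Submodule.span_mono hsub hmem)

/-! ### Rational coefficients for integer points -/

/-- Moving along `g` until a coordinate vanishes. -/
theorem exists_add_smul_nonneg_support_ssubset {ι : Type*} [Fintype ι] {c g : ι → ℝ}
    (hc : ∀ i, 0 ≤ c i) (hg : g ≠ 0) (hsupp : ∀ i, c i = 0 → g i = 0) :
    ∃ t : ℝ, (∀ i, 0 ≤ c i + t * g i) ∧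
      Function.support (fun i => c i + t * g i) ⊂ Function.support c := by
  wlog hpos : ∃ i, 0 < g i generalizing g with H
  · obtain ⟨i, hi⟩ := Function.ne_iff.mp hg
    push Not at hpos
    obtain ⟨t, ht⟩ := H (g := -g) (neg_ne_zero.mpr hg) (fun i hi => by simp [hsupp i hi])
      ⟨i, by simpa using lt_of_le_of_ne (hpos i) hi⟩
    exact ⟨-t, by simpa using ht⟩
  classical
  obtain ⟨i₀, hi₀, hmin⟩ := Finset.exists_min_image (Finset.univ.filter fun i => 0 < g i)
    (fun i => c i / g i) (by obtain ⟨i, hi⟩ := hpos; exact ⟨i, by simp [hi]⟩)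
  simp only [Finset.mem_filter, Finset.mem_univ, true_and] at hi₀ hmin
  refine ⟨-(c i₀ / g i₀), fun i => ?_, ?_⟩
  · rcases lt_or_ge 0 (g i) with h | h
    · have h2 := mul_le_mul_of_nonneg_right (hmin i h) h.le
      rw [div_mul_cancel₀ _ h.ne'] at h2
      linarith
    · have : 0 ≤ c i₀ / g i₀ * (-g i) :=
        mul_nonneg (div_nonneg (hc _) hi₀.le) (neg_nonneg.mpr h)
      have := hc i
      linarith
  · rw [Set.ssubset_iff_of_subset]
    · refine ⟨i₀, fun h => hi₀.ne' (hsupp i₀ h), ?_⟩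
      simp only [Function.mem_support, not_not]
      field_simp
      ring
    · intro i hi hci
      simp [hsupp i hci, hci] at hi

/-- An integer point of the cone over integer vectors is a nonnegative rational combination. -/
theorem exists_nonneg_rat_combination {ι κ : Type*} [Fintype ι] (v : ι → κ → ℤ) (z : κ → ℤ)
    (c : ι → ℝ) (hc : ∀ i, 0 ≤ c i) (hz : ∀ j, ∑ i, c i * v i j = z j) :
    ∃ q : ι → ℚ, (∀ i, 0 ≤ q i) ∧ ∀ j, ∑ i, q i * v i j = z j := by
  induction h : (Function.support c).ncard using Nat.strong_induction_on generalizing c with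
  | _ N ih =>
  subst h
  -- A `ℚ`-linear retraction `ℝ → ℚ` turns the coefficients into a rational solution, possibly with
  -- negative entries. If it differs from `c`, moving along the difference shrinks the support.
  obtain ⟨φ, hφ⟩ := LinearMap.exists_leftInverse_of_injective (Algebra.linearMap ℚ ℝ)
    (LinearMap.ker_eq_bot.mpr (algebraMap ℚ ℝ).injective)
  have hφ' : ∀ q : ℚ, φ q = q := fun q => LinearMap.congr_fun hφ q
  have hφmul : ∀ (x : ℝ) (a : ℤ), φ (x * a) = φ x * a := by
    intro x a
    rw [mul_comm, ← zsmul_eq_mul, map_zsmul, zsmul_eq_mul, mul_comm]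
  have hq : ∀ j, ∑ i, φ (c i) * v i j = z j := by
    intro j
    have := congrArg φ (hz j)
    rw [map_sum] at this
    simp only [hφmul] at this
    rw [this]
    exact_mod_cast hφ' (z j)
  by_cases hg : (fun i => c i - φ (c i)) = 0
  · have hcq : ∀ i, c i = φ (c i) := fun i => sub_eq_zero.mp (congrFun hg i)
    refine ⟨fun i => φ (c i), fun i => ?_, hq⟩
    have := hc i
    rw [hcq i] at this
    exact_mod_cast this
  · obtain ⟨t, ht, hlt⟩ := exists_add_smul_nonneg_support_ssubset hc hg
      (fun i hi => by simp [hi])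
    refine ih _ (Set.ncard_lt_ncard hlt (Set.toFinite _)) _ ht (fun j => ?_) rfl
    have hq' : ∑ i, (φ (c i) : ℝ) * v i j = z j := by exact_mod_cast hq j
    calc ∑ i, (c i + t * (c i - φ (c i))) * (v i j : ℝ)
        = ∑ i, c i * v i j + t * (∑ i, c i * v i j - ∑ i, (φ (c i) : ℝ) * v i j) := by
          rw [← Finset.sum_sub_distrib, Finset.mul_sum, ← Finset.sum_add_distrib]
          exact Finset.sum_congr rfl fun i _ => by ring
      _ = z j := by rw [hz, hq']; ring

theorem exists_nonneg_int_combination {ι κ : Type*} [Fintype ι] (v : ι → κ → ℤ) (z : κ → ℤ)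
    (c : ι → ℝ) (hc : ∀ i, 0 ≤ c i) (hz : ∀ j, ∑ i, c i * v i j = z j) :
    ∃ (n : ℤ) (x : ι → ℤ), 0 < n ∧ (∀ i, 0 ≤ x i) ∧ ∑ i, x i • v i = n • z := by
  obtain ⟨q, hq, hqz⟩ := exists_nonneg_rat_combination v z c hc hz
  obtain ⟨⟨n, hn⟩, hint⟩ := IsLocalization.exist_integer_multiples_of_finite
    (Submonoid.pos ℤ) q
  choose x hx using hint
  have hn : 0 < n := hn
  have hx : ∀ i, (x i : ℚ) = n * q i := fun i => by simpa [Algebra.smul_def] using hx i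
  refine ⟨n, x, hn, fun i => ?_, ?_⟩
  · have : (0 : ℚ) ≤ x i := by
      rw [hx]
      exact mul_nonneg (by exact_mod_cast hn.le) (hq i)
    exact_mod_cast this
  · ext j
    have : (((∑ i, x i • v i) j : ℤ) : ℚ) = ((n • z) j : ℤ) := by
      simp only [Finset.sum_apply, Pi.smul_apply, smul_eq_mul]
      push_cast
      rw [← hqz, Finset.mul_sum]
      exact Finset.sum_congr rfl fun i _ => by rw [hx]; ring
    exact_mod_cast this

/-! ### The two implications -/

namespace NumericalSemigroup

theorem IsQuotient.isRayNormalescent {k : ℕ} {S : NumericalSemigroup} (h : S.IsQuotient k) :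
    S.IsRayNormalescent k := by
  obtain ⟨d, a, hd, ha, rfl⟩ := h
  set z : Fin k → Fin (k + 1) → ℤ := fun i => Fin.cons (a i : ℤ) (Pi.single i (d : ℤ)) with hz
  set w : Fin k → Fin (k + 1) → ℝ := fun i j => (z i j : ℝ) with hw
  have hw0 : ∀ i, w i 0 = a i := fun i => by simp [hw, hz]
  have hws : ∀ i j, w i (Fin.succ j) = if j = i then (d : ℝ) else 0 := fun i j => by
    simp [hw, hz, Pi.single_apply]
  have hd' : (0 : ℝ) < d := by exact_mod_cast hd
  have ha' : ∀ i, (0 : ℝ) < a i := fun i => by exact_mod_cast ha i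
  have hsum0 : ∀ c : Fin k → ℝ, (∑ i, c i • w i) 0 = ∑ i, c i * a i := fun c => by
    simp [Finset.sum_apply, hw0]
  have hsums : ∀ (c : Fin k → ℝ) (j : Fin k), (∑ i, c i • w i) j.succ = c j * d := fun c j => by
    simp [Finset.sum_apply, hws]
  have hnonneg : ∀ x ∈ PointedCone.hull ℝ (Set.range w), 0 ≤ x 0 := by
    intro x hx
    obtain ⟨c, hc, rfl⟩ := PointedCone.mem_hull_range_iff.mp hx
    rw [hsum0]
    exact Finset.sum_nonneg fun i _ => mul_nonneg (hc i) (ha' i).le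
  have hsal : (PointedCone.hull ℝ (Set.range w) : ConvexCone ℝ (Fin (k + 1) → ℝ)).Salient := by
    intro x hx hx0 hneg
    have h1 := hnonneg (-x) hneg
    obtain ⟨c, hc, rfl⟩ := PointedCone.mem_hull_range_iff.mp hx
    rw [Pi.neg_apply, hsum0] at h1
    have h2 : ∀ i ∈ Finset.univ, 0 ≤ c i * a i := fun i _ => mul_nonneg (hc i) (ha' i).le
    have h3 := (Finset.sum_eq_zero_iff_of_nonneg h2).mp
      (le_antisymm (by linarith) (Finset.sum_nonneg h2))
    refine hx0 (Finset.sum_eq_zero fun i hi => ?_)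
    rw [(mul_eq_zero.mp (h3 i hi)).resolve_right (ha' i).ne', zero_smul]
  have hinj : Function.Injective w := by
    intro i j hij
    have := congrFun hij i.succ
    rw [hws, hws, if_pos rfl] at this
    by_contra hne
    rw [if_neg hne] at this
    exact hd'.ne' this
  -- Coordinate `i + 1` vanishes on every generator except `w i`.
  have hmin : ∀ v ∈ Set.range w, v ∉ PointedCone.hull ℝ (Set.range w \ {v}) := by
    rintro _ ⟨i, rfl⟩ hmem
    have hle : PointedCone.hull ℝ (Set.range w \ {w i}) ≤
        PointedCone.ofSubmodule (LinearMap.ker (LinearMap.proj (R := ℝ) (φ := fun _ => ℝ) i.succ)) := by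
      refine Submodule.span_le.mpr ?_
      rintro _ ⟨⟨j, rfl⟩, hj⟩
      have hne : i ≠ j := fun h => hj (by rw [h]; rfl)
      change w j i.succ = 0
      rw [hws, if_neg hne]
    have h0 : w i i.succ = 0 := hle hmem
    rw [hws, if_pos rfl] at h0
    exact hd'.ne' h0
  refine ⟨k + 1, PointedCone.hull ℝ (Set.range w), LinearMap.proj 0,
    ⟨Set.range w, Set.finite_range w, ?_, rfl⟩, hsal, ?_, ?_, hnonneg, ?_⟩
  · rintro _ ⟨i, rfl⟩
    exact ⟨z i, rfl⟩
  · rw [encard_extremeRays_hull hsal hmin, ← Set.image_univ, hinj.encard_image, Set.encard_univ]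
    simp
  · intro i
    by_cases h : i = 0
    · exact ⟨1, by simp [h]⟩
    · exact ⟨0, by simp [h]⟩
  · ext y
    constructor
    · rintro ⟨t, ht, rfl⟩
      obtain ⟨x, hx⟩ := (AddSubmonoid.mem_closure_range_nat_iff a (d * t)).mp ht
      have hx' : ∑ i, (x i : ℝ) * a i = d * t := by exact_mod_cast hx
      refine ⟨∑ i, ((x i : ℝ) / d) • w i, ⟨PointedCone.mem_hull_range_iff.mpr
        ⟨_, fun i => by positivity, rfl⟩, Fin.cons (t : ℤ) (fun i => (x i : ℤ)), ?_⟩, ?_⟩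
      · ext j
        refine Fin.cases ?_ (fun j => ?_) j
        · rw [hsum0]
          simp only [Fin.cons_zero, Int.cast_natCast, div_mul_eq_mul_div, ← Finset.sum_div, hx']
          field_simp
        · rw [hsums]
          simp [hd'.ne']
      · change (∑ i, ((x i : ℝ) / d) • w i) 0 = t
        rw [hsum0]
        simp only [div_mul_eq_mul_div, ← Finset.sum_div, hx']
        field_simp
    · rintro ⟨p, ⟨hp, q, rfl⟩, rfl⟩
      have hq0 : (0 : ℝ) ≤ q 0 := hnonneg _ hp
      obtain ⟨c, hc, hcq⟩ := PointedCone.mem_hull_range_iff.mp hp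
      have h0 := congrFun hcq 0
      have hs := fun j : Fin k => congrFun hcq j.succ
      rw [hsum0] at h0
      change _ = (q 0 : ℝ) at h0
      simp only [hsums] at hs
      have hqs : ∀ j : Fin k, 0 ≤ q j.succ := fun j => by
        have : (0 : ℝ) ≤ q j.succ := by
          rw [← hs]
          exact mul_nonneg (hc j) hd'.le
        exact_mod_cast this
      have hq0 : 0 ≤ q 0 := by exact_mod_cast hq0
      refine ⟨(q 0).toNat, (AddSubmonoid.mem_closure_range_nat_iff a _).mpr
        ⟨fun i => (q i.succ).toNat, ?_⟩, ?_⟩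
      · zify
        simp only [Int.toNat_of_nonneg (hqs _), Int.toNat_of_nonneg hq0]
        have : ∑ i, (q i.succ : ℝ) * a i = d * q 0 := by
          rw [← h0, Finset.mul_sum]
          exact Finset.sum_congr rfl fun i _ => by rw [← hs]; ring
        exact_mod_cast this
      · change _ = (q 0 : ℝ)
        exact_mod_cast Int.toNat_of_nonneg hq0

theorem IsRayNormalescent.isQuotient {k : ℕ} {S : NumericalSemigroup} (hS : S ≠ ⊥)
    (h : S.IsRayNormalescent k) : S.IsQuotient k := by
  obtain ⟨m, C, π, ⟨V, hVfin, hVint, rfl⟩, hsal, hcard, hint, hnonneg, himage⟩ := h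
  obtain ⟨W, hWV, hW, hWmin⟩ := PointedCone.exists_minimal_hull_eq hVfin
  rw [← hW] at hsal hcard hnonneg himage
  rw [encard_extremeRays_hull hsal hWmin] at hcard
  have hWfin : W.Finite := hVfin.subset hWV
  obtain ⟨w, rfl⟩ : ∃ w : Fin k → Fin m → ℝ, Set.range w = W := by
    have := hWfin.fintype
    have hk : Fintype.card W = k := by
      rw [← Nat.card_eq_fintype_card, Nat.card_coe_set_eq, Set.ncard, hcard]
      rfl
    refine ⟨fun i => ((Fintype.equivFinOfCardEq hk).symm i : W), ?_⟩
    rw [Set.range_comp' Subtype.val, Equiv.range_eq_univ, Set.image_univ, Subtype.range_coe]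
  choose v hv using fun i => hVint (hWV (Set.mem_range_self i))
  have hv : ∀ i j, w i j = v i j := fun i j => (congrFun (hv i) j).symm
  choose e he using hint
  set πZ : (Fin m → ℤ) →ₗ[ℤ] ℤ := Fintype.linearCombination ℤ e with hπZ
  have hπ : ∀ z : Fin m → ℤ, π (fun i => (z i : ℝ)) = (πZ z : ℤ) := by
    intro z
    rw [pi_eq_sum_univ' (fun i => (z i : ℝ)), map_sum]
    simp [he, hπZ, Fintype.linearCombination_apply]
  have hwmem : ∀ i, w i ∈ PointedCone.hull ℝ (Set.range w) := fun i =>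
    Submodule.subset_span (Set.mem_range_self i)
  have hvpos : ∀ i, 0 ≤ πZ (v i) := by
    intro i
    have := hnonneg _ (hwmem i)
    rw [funext (hv i), hπ] at this
    exact_mod_cast this
  obtain ⟨T, hT⟩ := Nat.addSubmonoid_fg S
  have hrep : ∀ s ∈ S, ∃ (n : ℤ) (x : Fin k → ℤ) (z : Fin m → ℤ), 0 < n ∧ (∀ i, 0 ≤ x i) ∧
      ∑ i, x i • v i = n • z ∧ πZ z = s := by
    intro s hs
    have hs' : (s : ℝ) ∈ (Nat.cast '' (S : Set ℕ) : Set ℝ) := ⟨s, hs, rfl⟩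
    rw [himage] at hs'
    obtain ⟨p, ⟨hp, z, rfl⟩, hps⟩ := hs'
    obtain ⟨c, hc, hcz⟩ := PointedCone.mem_hull_range_iff.mp hp
    obtain ⟨n, x, hn, hx, hxz⟩ := exists_nonneg_int_combination v z c hc (fun j => by
      have := congrFun hcz j
      simpa [Finset.sum_apply, hv] using this)
    refine ⟨n, x, z, hn, hx, hxz, ?_⟩
    rw [hπ] at hps
    exact_mod_cast hps
  choose! n x z hn hx hxz hz using hrep
  have hTS : ∀ s ∈ T, s ∈ S := fun s hs => hT ▸ AddSubmonoid.subset_closure hs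
  -- Only the finitely many generators of `S` need a common denominator.
  have hnpos : 0 < ∏ s ∈ T, n s := Finset.prod_pos fun s hs => hn s (hTS s hs)
  refine isQuotient_of_rational_cone v πZ (∏ s ∈ T, n s) hnpos hvpos S hS T hT ?_ ?_
  · intro x z hx hxz
    have hmem : (fun j => (z j : ℝ)) ∈ PointedCone.hull ℝ (Set.range w) := by
      rw [PointedCone.mem_hull_range_iff]
      have hN : (0 : ℝ) < ((∏ s ∈ T, n s : ℤ) : ℝ) := by exact_mod_cast hnpos
      refine ⟨fun i => (x i : ℝ) / ((∏ s ∈ T, n s : ℤ) : ℝ), fun i =>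
        div_nonneg (by exact_mod_cast hx i) hN.le, ?_⟩
      ext j
      have hj : ∑ i, (x i : ℝ) * v i j = ((∏ s ∈ T, n s : ℤ) : ℝ) * z j := by
        have := congrFun hxz j
        simp only [Finset.sum_apply, Pi.smul_apply, smul_eq_mul] at this
        exact_mod_cast this
      simp only [Finset.sum_apply, Pi.smul_apply, smul_eq_mul, hv, div_mul_eq_mul_div,
        ← Finset.sum_div]
      rw [hj, mul_div_cancel_left₀ _ hN.ne']
    have himg : π (fun j => (z j : ℝ)) ∈ (Nat.cast '' (S : Set ℕ) : Set ℝ) := by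
      rw [himage]
      exact ⟨_, ⟨hmem, z, rfl⟩, rfl⟩
    obtain ⟨s, hs, hsz⟩ := himg
    rw [hπ] at hsz
    exact ⟨s, hs, by exact_mod_cast hsz.symm⟩
  · intro s hs
    obtain ⟨q, hq⟩ := Finset.dvd_prod_of_mem n hs
    have hq0 : 0 ≤ q := by
      rw [hq] at hnpos
      exact (pos_of_mul_pos_right hnpos (hn s (hTS s hs)).le).le
    refine ⟨fun i => q * x s i, z s, fun i => mul_nonneg hq0 (hx s (hTS s hs) i), ?_,
      hz s (hTS s hs)⟩
    simp only [mul_smul]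
    rw [← Finset.smul_sum, hxz s (hTS s hs), hq, smul_smul, mul_comm]

end NumericalSemigroup

theorem theorem1p4 (k : ℕ) (S : NumericalSemigroup) (hS : S ≠ ⊥) :
    S.IsQuotient k ↔ S.IsRayNormalescent k :=
  ⟨NumericalSemigroup.IsQuotient.isRayNormalescent,
    NumericalSemigroup.IsRayNormalescent.isQuotient hS⟩
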